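/- Let $N\ge 2$, let $\Omega\subset\mathbb R^N$ be a bounded open set with smooth boundary $\Gamma$, and let $\Gamma_1,\Gamma_2$ be disjoint relatively open subsets of $\Gamma$ with $\Gamma=\overline{\Gamma}_1\cup\overline{\Gamma}_2$ and $\mathrm{meas}(\Gamma_1)>0$. Let $Y=(-\tfrac12,\tfrac12)^N$, let $T\subset Y$ be a compact set with smooth boundary and nonempty interior, put $Y^*=Y\setminus T$, and let $\sigma$ be the surface measure on $\partial T$. "$Y$-periodic" means periodic (a.e.) with respect to $\mathbb Z^N$. Let $a_{ijkh}\in L^\infty(\mathbb R^N)$ ($1\le i,j,k,h\le N$) be real $Y$-periodic functions such that a.e. $a_{ijkh}=a_{jihk}=a_{khij}$ and, for some constant $\alpha>0$ and a.e. $y$, $$\sum_{i,j,k,h}a_{ijkh}(y)\zeta_{ij}\zeta_{kh}\ge\alpha|\zeta|^2\qquad\text{for all }\zeta\in\mathbb R^{N\times N}.$$ Let $\theta\in L^\infty(\mathbb R^N)$ be real and $Y$-periodic with $\theta\ge\alpha_0$ a.e. in $\mathbb R^N$ for a constant $\alpha_0>0$; assume moreover that $\theta$ has values on $\partial T$ that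 are $\sigma$-integrable and satisfy $\theta\ge\alpha_0$ $\sigma$-a.e. on $\partial T$. Let $\mathbf f\in L^\infty(\mathbb R^N)^N$ be real and $Y$-periodic, and let $\mathbf t\in L^2(\Gamma)^N$ be real. Write $e_{ij}(\mathbf v)=\frac12\left(\frac{\partial v^i}{\partial x_j}+\frac{\partial v^j}{\partial x_i}\right)$, and $e^y_{ij}$ for the same expression with derivatives in $y$. Let $\mathbf V_Y$ be the space of $Y$-periodic vector fields in $H^1_{loc}(\mathbb R^N;\mathbb R)^N$ with mean value zero over $Y$. For all $i,j$ let $\boldsymbol\chi^{ij}\in\mathbf V_Y$ be any solution of the cell problem $$\sum_{p,q,k,h}\int_{Y^*}a_{pqkh}\,e^y_{pq}(\boldsymbol\chi^{ij})\,e^y_{kh}(\mathbf w)\,dy=\sum_{k,h}\int_{Y^*}a_{ijkh}\,e^y_{kh}(\mathbf w)\,dy\qquad\text{for all }\mathbf w\in\mathbf V_Y,$$ and put $$q_{ijkh}=\int_{Y^*}a_{ijkh}\,dy-\sum_{p,q}\int_{Y^*}a_{pqkh}\,e^y_{pq}(\boldsymbol\chi^{ij})\,dy,\quad \widetilde\theta=\int_{\partial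 T}\theta\,d\sigma,\quad \widetilde{\mathbf f}=\int_{Y^*}\mathbf f\,dy,\quad \sigma^0_{ij}(\mathbf u)=\sum_{k,h}q_{ijkh}\,e_{kh}(\mathbf u).$$ Let $\mathbf V_0=\{\mathbf v\in H^1(\Omega;\mathbb R)^N:\mathbf v=0\text{ on }\Gamma_1\text{ in the sense of traces}\}$. A weak solution in $\mathbf V_0$ of the homogenized boundary value problem $$-\operatorname{div}\sigma^0(\mathbf u_0)+\widetilde\theta\,\mathbf u_0=\widetilde{\mathbf f}\ \text{ in }\Omega,\qquad \mathbf u_0=0\ \text{ on }\Gamma_1,\qquad \sigma^0(\mathbf u_0)\mathbf n=\mathbf t\ \text{ on }\Gamma_2$$ is a field $\mathbf u_0\in\mathbf V_0$ such that, for all $\mathbf v\in\mathbf V_0$, $$\sum_{i,j}\int_\Omega\sigma^0_{ij}(\mathbf u_0)\,e_{ij}(\mathbf v)\,dx+\int_\Omega\widetilde\theta\,\mathbf u_0\cdot\mathbf v\,dx=\int_\Omega\widetilde{\mathbf f}\cdot\mathbf v\,dx+\int_{\Gamma_2}\mathbf t\cdot\mathbf v\,d\Gamma .$$ **Proposition 3.2.**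 This problem has at most one weak solution in $\mathbf V_0$: any two weak solutions are equal a.e. in $\Omega$. -/

import Mathlib

open MeasureTheory Filter Topology
open scoped ContDiff ENNReal

noncomputable section

namespace Elasticity

/-- The Euclidean space `ℝ^N`. -/
abbrev Sp (N : ℕ) : Type := EuclideanSpace ℝ (Fin N)

variable {N : ℕ}

/-! ### Geometry -/

/-- The open unit cube `Y = (-1/2, 1/2)^N`. -/
def unitCell (N : ℕ) : Set (Sp N) := {y | ∀ i, -(1 / 2 : ℝ) < y i ∧ y i < 1 / 2}

/-- The set `S` has a smooth boundary: near each boundary point there is a smooth defining function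
with non-vanishing differential, negative inside `S`, zero on the boundary, positive outside. -/
def HasSmoothBoundary (S : Set (Sp N)) : Prop :=
  ∀ x ∈ frontier S, ∃ U : Set (Sp N), IsOpen U ∧ x ∈ U ∧
    ∃ ρ : Sp N → ℝ, ContDiff ℝ ∞ ρ ∧ fderiv ℝ ρ x ≠ 0 ∧
      ∀ y ∈ U, (y ∈ interior S ↔ ρ y < 0) ∧ (y ∈ frontier S ↔ ρ y = 0)

/-- The `(N-1)`-dimensional surface measure on a set `S`: the Hausdorff measure, normalized so that
it agrees with Lebesgue measure on hyperplanes, restricted to `S`. -/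
def surfaceMeasure (S : Set (Sp N)) : Measure (Sp N) :=
  (Measure.euclideanHausdorffMeasure (N - 1)).restrict S

/-- The integer vector `k ∈ ℤ^N` as a point of `ℝ^N`. -/
def latticePoint (k : Fin N → ℤ) : Sp N := WithLp.toLp 2 (fun i => (k i : ℝ))

/-- `Y`-periodicity: `u (y + k) = u y` for every `k ∈ ℤ^N` and almost every `y`. -/
def IsYPeriodic {F : Type*} (u : Sp N → F) : Prop :=
  ∀ k : Fin N → ℤ, ∀ᵐ y ∂(volume : Measure (Sp N)), u (y + latticePoint k) = u y

/-! ### Weak derivatives and Sobolev spaces -/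

/-- The classical partial derivative `∂φ/∂x_i`. -/
def partialDeriv (i : Fin N) (φ : Sp N → ℝ) (x : Sp N) : ℝ :=
  fderiv ℝ φ x (EuclideanSpace.single i 1)

/-- `g` is a weak partial derivative `∂u/∂x_i` on the open set `U` (both in `L¹_loc(U)`). -/
def HasWeakPartial (U : Set (Sp N)) (i : Fin N) (u g : Sp N → ℝ) : Prop :=
  LocallyIntegrableOn u U ∧ LocallyIntegrableOn g U ∧
    ∀ φ : Sp N → ℝ, ContDiff ℝ ∞ φ → HasCompactSupport φ → tsupport φ ⊆ U →
      ∫ x in U, u x * partialDeriv i φ x = - ∫ x in U, g x * φ x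

open Classical in
/-- The weak partial derivative `∂u/∂x_i` on `U` (determined up to a null set); the value `0` is
taken when there is none. -/
def weakPartial (U : Set (Sp N)) (i : Fin N) (u : Sp N → ℝ) : Sp N → ℝ :=
  if h : ∃ g, HasWeakPartial U i u g then h.choose else 0

/-- The `j`-th component of a vector field. -/
def comp (u : Sp N → Sp N) (j : Fin N) : Sp N → ℝ := fun x => u x j

/-- The scalar Sobolev space `H¹(U)` of real functions. -/
def MemH1 (U : Set (Sp N)) (u : Sp N → ℝ) : Prop :=
  MemLp u 2 (volume.restrict U) ∧
    ∀ i, ∃ g, HasWeakPartial U i u g ∧ MemLp g 2 (volume.restrict U)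

/-- The scalar space `H¹_#(Y)`: functions in `H¹_loc(ℝ^N)` that are `Y`-periodic and have mean value
zero over `Y`. -/
def MemH1Sharp (u : Sp N → ℝ) : Prop :=
  (∀ K : Set (Sp N), IsCompact K → MemLp u 2 (volume.restrict K)) ∧
  (∀ i, ∃ g, HasWeakPartial Set.univ i u g ∧
    ∀ K : Set (Sp N), IsCompact K → MemLp g 2 (volume.restrict K)) ∧
  IsYPeriodic u ∧ ∫ y in unitCell N, u y = 0

/-- The space `V_Y = H¹_#(Y; ℝ)^N`. -/
def VY (N : ℕ) : Set (Sp N → Sp N) := {w | ∀ j, MemH1Sharp (comp w j)}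

/-- The linearized strain `e_ij(u) = (∂u^i/∂x_j + ∂u^j/∂x_i) / 2` on `U`. -/
def strain (U : Set (Sp N)) (u : Sp N → Sp N) (i j : Fin N) (x : Sp N) : ℝ :=
  (1 / 2) * (weakPartial U j (comp u i) x + weakPartial U i (comp u j) x)

/-- `g ∈ L²(∂Ω)^N` is the trace on `∂Ω` of `u ∈ H¹(Ω)^N`: smooth fields on the closure of `Ω` converge
to `u` in `H¹(Ω)^N` while their restrictions to `∂Ω` converge to `g` in `L²(∂Ω)^N`. -/
def IsTrace (Ω : Set (Sp N)) (u g : Sp N → Sp N) : Prop :=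
  (∀ j, MemH1 Ω (comp u j)) ∧ MemLp g 2 (surfaceMeasure (frontier Ω)) ∧
  ∃ φ : ℕ → Sp N → Sp N,
    (∀ n, ContDiff ℝ ∞ (φ n) ∧ HasCompactSupport (φ n)) ∧
    Tendsto (fun n => eLpNorm (φ n - u) 2 (volume.restrict Ω)) atTop (𝓝 0) ∧
    (∀ i j, Tendsto (fun n => eLpNorm
      (partialDeriv i (comp (φ n) j) - weakPartial Ω i (comp u j)) 2 (volume.restrict Ω))
      atTop (𝓝 0)) ∧
    Tendsto (fun n => eLpNorm (φ n - g) 2 (surfaceMeasure (frontier Ω))) atTop (𝓝 0)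

/-- The trace `g` vanishes (surface-almost everywhere) on `Γ₁`. -/
def VanishesOn (Γ₁ : Set (Sp N)) (g : Sp N → Sp N) : Prop :=
  ∀ᵐ x ∂(surfaceMeasure Γ₁), g x = 0

/-- The space `V₀ = {v ∈ H¹(Ω; ℝ)^N : v = 0 on Γ₁}`, the boundary condition being in the sense of
traces. -/
def V0 (Ω Γ₁ : Set (Sp N)) : Set (Sp N → Sp N) :=
  {v | (∀ j, MemH1 Ω (comp v j)) ∧ ∃ g, IsTrace Ω v g ∧ VanishesOn Γ₁ g}

/-! ### Cell problems and homogenized quantities -/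

/-- A family of `N^4` scalar functions on `ℝ^N`, indexed by `i j k h`. -/
abbrev Coeff (N : ℕ) : Type := Fin N → Fin N → Fin N → Fin N → Sp N → ℝ

/-- `χ` solves the cell problem with index `(i, j)` on the perforated cell `Y* = Y \ T`. -/
def IsCellSolution (T : Set (Sp N)) (a : Coeff N) (i j : Fin N) (χ : Sp N → Sp N) : Prop :=
  χ ∈ VY N ∧ ∀ w ∈ VY N,
    ∑ p, ∑ q, ∑ k, ∑ h, ∫ y in unitCell N \ T,
        a p q k h y * strain Set.univ χ p q y * strain Set.univ w k h y =
      ∑ k, ∑ h, ∫ y in unitCell N \ T, a i j k h y * strain Set.univ w k h y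

/-- The homogenized coefficients `q_ijkh`. -/
def homCoeff (T : Set (Sp N)) (a : Coeff N) (χ : Fin N → Fin N → Sp N → Sp N)
    (i j k h : Fin N) : ℝ :=
  (∫ y in unitCell N \ T, a i j k h y) -
    ∑ p, ∑ q, ∫ y in unitCell N \ T, a p q k h y * strain Set.univ (χ i j) p q y

/-- `θ̃ = ∫_{∂T} θ dσ`. -/
def homTheta (T : Set (Sp N)) (θ : Sp N → ℝ) : ℝ := ∫ y, θ y ∂(surfaceMeasure (frontier T))

/-- `f̃ = ∫_{Y*} f dy`. -/
def homForce (T : Set (Sp N)) (f : Sp N → Sp N) : Sp N := ∫ y in unitCell N \ T, f y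

/-- The homogenized stress `σ⁰_ij(u) = ∑_kh q_ijkh e_kh(u)`. -/
def homStress (Ω : Set (Sp N)) (q : Fin N → Fin N → Fin N → Fin N → ℝ) (u : Sp N → Sp N)
    (i j : Fin N) (x : Sp N) : ℝ :=
  ∑ k, ∑ h, q i j k h * strain Ω u k h x

/-- `u ∈ V₀` is a weak solution of `-div σ⁰(u) + ϑ u = F` in `Ω`, `u = 0` on `Γ₁`, `σ⁰(u) n = t` on
`Γ₂`. In the boundary term the test field `v` is represented by its trace `g`. -/
def IsWeakSolution (Ω Γ₁ Γ₂ : Set (Sp N)) (q : Fin N → Fin N → Fin N → Fin N → ℝ) (ϑ : ℝ)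
    (F : Sp N) (t : Sp N → Sp N) (u : Sp N → Sp N) : Prop :=
  u ∈ V0 Ω Γ₁ ∧
  ∀ v ∈ V0 Ω Γ₁, ∀ g, IsTrace Ω v g →
    (∑ i, ∑ j, ∫ x in Ω, homStress Ω q u i j x * strain Ω v i j x)
        + ∫ x in Ω, ϑ * inner ℝ (u x) (v x) =
      (∫ x in Ω, inner ℝ F (v x)) + ∫ x, inner ℝ (t x) (g x) ∂(surfaceMeasure Γ₂)

end Elasticity

end

namespace Elasticity

variable {N : ℕ}

/-! ### Weak derivatives -/

/-! The difference `d` of two weak solutions is an admissible test field. Testing both equations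
with `d` and the same trace of `d` cancels the loads and leaves `∫ σ⁰(d) : e(d) + θ̃ ∫ |d|² = 0`. If
`q` is positive semidefinite and `θ̃ > 0`, both terms vanish and `d = 0`; since the zeroth-order
term controls `d`, no coercivity of `q` is required (`IsWeakSolution.ae_eq`).

Semidefiniteness: by the cell equations tested with the correctors themselves, `∑ q ζ ζ` is the
elastic energy over the perforated cell of the constant strain `ζ` minus its corrector strain
(`sum_corrected_nonneg`, `sum_homCoeff_nonneg`).

Positivity: `θ` is bounded below on `∂T`, and `∂T` has nonzero surface measure because its
projection along an axis covers that of the interior of `T`, a nonempty open set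
(`surfaceMeasure_frontier_ne_zero`, `homTheta_pos`). -/

lemma integrableOn_mul_of_tsupport_subset {U : Set (Sp N)} {u ψ : Sp N → ℝ}
    (hu : LocallyIntegrableOn u U) (hψ : Continuous ψ) (hc : HasCompactSupport ψ)
    (hs : tsupport ψ ⊆ U) : IntegrableOn (fun x => u x * ψ x) U := by
  have h1 : IntegrableOn u (tsupport ψ) := hu.integrableOn_compact_subset hs hc
  have h2 : IntegrableOn (fun x => u x * ψ x) (tsupport ψ) :=
    h1.mul_continuousOn hψ.continuousOn hc
  have h3 : Integrable (fun x => u x * ψ x) :=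
    (integrableOn_iff_integrable_of_support_subset
      ((Function.support_mul_subset_right u ψ).trans (subset_tsupport ψ))).1 h2
  exact h3.integrableOn

lemma continuous_partialDeriv (i : Fin N) {φ : Sp N → ℝ} (hφ : ContDiff ℝ ∞ φ) :
    Continuous (partialDeriv i φ) :=
  (hφ.continuous_fderiv (by simp)).clm_apply continuous_const

lemma tsupport_partialDeriv_subset (i : Fin N) (φ : Sp N → ℝ) :
    tsupport (partialDeriv i φ) ⊆ tsupport φ :=
  tsupport_fderiv_apply_subset ℝ _

lemma partialDeriv_sub (i : Fin N) {φ ψ : Sp N → ℝ} (hφ : ContDiff ℝ ∞ φ)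
    (hψ : ContDiff ℝ ∞ ψ) :
    partialDeriv i (φ - ψ) = partialDeriv i φ - partialDeriv i ψ := by
  ext x
  simp [partialDeriv, fderiv_sub (hφ.differentiable (by simp) x)
    (hψ.differentiable (by simp) x)]

lemma HasWeakPartial.sub {U : Set (Sp N)} {i : Fin N} {u v g h : Sp N → ℝ}
    (hu : HasWeakPartial U i u g) (hv : HasWeakPartial U i v h) :
    HasWeakPartial U i (u - v) (g - h) := by
  refine ⟨hu.1.sub hv.1, hu.2.1.sub hv.2.1, fun φ hφ hc hs => ?_⟩
  have hc' : HasCompactSupport (partialDeriv i φ) := hc.fderiv_apply ℝ _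
  have hs' := (tsupport_partialDeriv_subset i φ).trans hs
  have hd := continuous_partialDeriv i hφ
  simp only [Pi.sub_apply, sub_mul]
  rw [integral_sub (integrableOn_mul_of_tsupport_subset hu.1 hd hc' hs')
      (integrableOn_mul_of_tsupport_subset hv.1 hd hc' hs'),
    integral_sub (integrableOn_mul_of_tsupport_subset hu.2.1 hφ.continuous hc hs)
      (integrableOn_mul_of_tsupport_subset hv.2.1 hφ.continuous hc hs),
    hu.2.2 φ hφ hc hs, hv.2.2 φ hφ hc hs]
  ring

/-- The fundamental lemma of the calculus of variations. As `weakPartial` is an arbitrary choice,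
this is what makes it linear and square integrable, up to null sets. -/
lemma HasWeakPartial.ae_eq {U : Set (Sp N)} (hU : IsOpen U) {i : Fin N} {u g h : Sp N → ℝ}
    (hg : HasWeakPartial U i u g) (hh : HasWeakPartial U i u h) :
    g =ᵐ[volume.restrict U] h := by
  have key := hU.ae_eq_zero_of_integral_contDiff_smul_eq_zero (μ := volume)
    (hg.2.1.sub hh.2.1) (fun φ hφ hc hs => by
      have h0 : ∀ x, φ x • (g - h) x = g x * φ x - h x * φ x := fun x => by
        simp only [Pi.sub_apply, smul_eq_mul]; ring
      have hsupp : ∀ x, x ∉ U → φ x • (g - h) x = 0 := fun x hx => by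
        rw [image_eq_zero_of_notMem_tsupport (fun hx' => hx (hs hx')), zero_smul]
      rw [← setIntegral_eq_integral_of_forall_compl_eq_zero hsupp]
      simp only [h0]
      rw [integral_sub (integrableOn_mul_of_tsupport_subset hg.2.1 hφ.continuous hc hs)
        (integrableOn_mul_of_tsupport_subset hh.2.1 hφ.continuous hc hs)]
      have e1 := hg.2.2 φ hφ hc hs
      have e2 := hh.2.2 φ hφ hc hs
      linarith)
  refine (ae_restrict_iff' hU.measurableSet).2 ?_
  filter_upwards [key] with x hx hxU
  exact sub_eq_zero.1 (hx hxU)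

lemma HasWeakPartial.weakPartial_ae_eq {U : Set (Sp N)} (hU : IsOpen U) {i : Fin N}
    {u g : Sp N → ℝ} (hg : HasWeakPartial U i u g) :
    weakPartial U i u =ᵐ[volume.restrict U] g := by
  have hex : ∃ g, HasWeakPartial U i u g := ⟨g, hg⟩
  rw [weakPartial, dif_pos hex]
  exact hex.choose_spec.ae_eq hU hg

lemma MemH1.memLp_weakPartial {U : Set (Sp N)} (hU : IsOpen U) {u : Sp N → ℝ}
    (hu : MemH1 U u) (i : Fin N) : MemLp (weakPartial U i u) 2 (volume.restrict U) := by
  obtain ⟨g, hg, hgL⟩ := hu.2 i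
  exact hgL.ae_eq (hg.weakPartial_ae_eq hU).symm

lemma MemH1.weakPartial_sub {U : Set (Sp N)} (hU : IsOpen U) {u v : Sp N → ℝ}
    (hu : MemH1 U u) (hv : MemH1 U v) (i : Fin N) :
    weakPartial U i (u - v) =ᵐ[volume.restrict U] weakPartial U i u - weakPartial U i v := by
  obtain ⟨g, hg, -⟩ := hu.2 i
  obtain ⟨h, hh, -⟩ := hv.2 i
  exact ((hg.sub hh).weakPartial_ae_eq hU).trans
    ((hg.weakPartial_ae_eq hU).sub (hh.weakPartial_ae_eq hU)).symm

lemma MemH1.sub {U : Set (Sp N)} {u v : Sp N → ℝ} (hu : MemH1 U u) (hv : MemH1 U v) :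
    MemH1 U (u - v) := by
  refine ⟨hu.1.sub hv.1, fun i => ?_⟩
  obtain ⟨g, hg, hgL⟩ := hu.2 i
  obtain ⟨h, hh, hhL⟩ := hv.2 i
  exact ⟨g - h, hg.sub hh, hgL.sub hhL⟩

lemma memLp_strain {Ω : Set (Sp N)} (hΩ : IsOpen Ω) {u : Sp N → Sp N}
    (hu : ∀ j, MemH1 Ω (comp u j)) (i j : Fin N) :
    MemLp (strain Ω u i j) 2 (volume.restrict Ω) :=
  (((hu i).memLp_weakPartial hΩ j).add ((hu j).memLp_weakPartial hΩ i)).const_mul (1 / 2)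

lemma strain_sub {Ω : Set (Sp N)} (hΩ : IsOpen Ω) {u v : Sp N → Sp N}
    (hu : ∀ j, MemH1 Ω (comp u j)) (hv : ∀ j, MemH1 Ω (comp v j)) (i j : Fin N) :
    strain Ω (u - v) i j =ᵐ[volume.restrict Ω] strain Ω u i j - strain Ω v i j := by
  filter_upwards [(hu i).weakPartial_sub hΩ (hv i) j, (hu j).weakPartial_sub hΩ (hv j) i]
    with x h1 h2
  have e : ∀ j, comp (u - v) j = comp u j - comp v j := fun j => rfl
  simp only [strain, e, h1, h2, Pi.sub_apply]
  ring

/-! ### Traces -/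

lemma memLp_of_comp {μ : Measure (Sp N)} {u : Sp N → Sp N}
    (hu : ∀ j, MemLp (comp u j) 2 μ) : MemLp u 2 μ :=
  MemLp.of_eval_piLp hu

lemma tendsto_eLpNorm_sub_sub {F : Type*} [NormedAddCommGroup F] {μ : Measure (Sp N)}
    {φ ψ : ℕ → Sp N → F} {u v : Sp N → F}
    (hφm : ∀ n, AEStronglyMeasurable (φ n) μ) (hψm : ∀ n, AEStronglyMeasurable (ψ n) μ)
    (hum : AEStronglyMeasurable u μ) (hvm : AEStronglyMeasurable v μ)
    (hφ : Tendsto (fun n => eLpNorm (φ n - u) 2 μ) atTop (𝓝 0))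
    (hψ : Tendsto (fun n => eLpNorm (ψ n - v) 2 μ) atTop (𝓝 0)) :
    Tendsto (fun n => eLpNorm (φ n - ψ n - (u - v)) 2 μ) atTop (𝓝 0) := by
  refine tendsto_of_tendsto_of_tendsto_of_le_of_le tendsto_const_nhds
    (by simpa using hφ.add hψ) (fun n => zero_le) (fun n => ?_)
  simp only []
  rw [sub_sub_sub_comm]
  exact eLpNorm_sub_le ((hφm n).sub hum) ((hψm n).sub hvm) (by norm_num)

/-- Subtract the two approximating sequences; Minkowski's inequality gives all three limits. -/
lemma IsTrace.sub {Ω : Set (Sp N)} (hΩ : IsOpen Ω) {u v g h : Sp N → Sp N}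
    (hu : IsTrace Ω u g) (hv : IsTrace Ω v h) : IsTrace Ω (u - v) (g - h) := by
  obtain ⟨hu1, hg, φ, hφ, hφ0, hφ1, hφ2⟩ := hu
  obtain ⟨hv1, hh, ψ, hψ, hψ0, hψ1, hψ2⟩ := hv
  have hcomp : ∀ {η : Sp N → Sp N} (j : Fin N), ContDiff ℝ ∞ η → ContDiff ℝ ∞ (comp η j) :=
    fun j hη => (contDiff_piLp 2).1 hη j
  refine ⟨fun j => (hu1 j).sub (hv1 j), hg.sub hh, fun n => φ n - ψ n,
    fun n => ⟨(hφ n).1.sub (hψ n).1, (hφ n).2.sub (hψ n).2⟩, ?_, fun i j => ?_, ?_⟩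
  · exact tendsto_eLpNorm_sub_sub (fun n => (hφ n).1.continuous.aestronglyMeasurable)
      (fun n => (hψ n).1.continuous.aestronglyMeasurable)
      (memLp_of_comp fun j => (hu1 j).1).1 (memLp_of_comp fun j => (hv1 j).1).1 hφ0 hψ0
  · refine (tendsto_eLpNorm_sub_sub
      (fun n => (continuous_partialDeriv i (hcomp j (hφ n).1)).aestronglyMeasurable)
      (fun n => (continuous_partialDeriv i (hcomp j (hψ n).1)).aestronglyMeasurable)
      ((hu1 j).memLp_weakPartial hΩ i).1 ((hv1 j).memLp_weakPartial hΩ i).1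
      (hφ1 i j) (hψ1 i j)).congr fun n => ?_
    have e : partialDeriv i (comp (φ n - ψ n) j)
        = partialDeriv i (comp (φ n) j) - partialDeriv i (comp (ψ n) j) :=
      partialDeriv_sub i (hcomp j (hφ n).1) (hcomp j (hψ n).1)
    refine eLpNorm_congr_ae ?_
    filter_upwards [(hu1 j).weakPartial_sub hΩ (hv1 j) i] with x hx
    have e' : comp (u - v) j = comp u j - comp v j := rfl
    simp only [e, e', Pi.sub_apply, hx]
  · exact tendsto_eLpNorm_sub_sub (fun n => (hφ n).1.continuous.aestronglyMeasurable)
      (fun n => (hψ n).1.continuous.aestronglyMeasurable) hg.1 hh.1 hφ2 hψ2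

lemma sub_mem_V0 {Ω Γ₁ : Set (Sp N)} (hΩ : IsOpen Ω) {u v : Sp N → Sp N}
    (hu : u ∈ V0 Ω Γ₁) (hv : v ∈ V0 Ω Γ₁) : u - v ∈ V0 Ω Γ₁ := by
  obtain ⟨hu1, g, hg, hg0⟩ := hu
  obtain ⟨hv1, h, hh, hh0⟩ := hv
  refine ⟨fun j => (hu1 j).sub (hv1 j), g - h, hg.sub hΩ hh, ?_⟩
  filter_upwards [hg0, hh0] with x h1 h2
  simp [h1, h2]

/-! ### The surface measure of the boundary of a compact set -/

/-- The map `ℝ^(n+1) → ℝ^n` that forgets the first coordinate. -/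
noncomputable def dropFirst (n : ℕ) : Sp (n + 1) →ₗ[ℝ] Sp n where
  toFun x := WithLp.toLp 2 (fun i => x i.succ)
  map_add' _ _ := rfl
  map_smul' _ _ := rfl

lemma dropFirst_apply (n : ℕ) (x : Sp (n + 1)) (i : Fin n) : dropFirst n x i = x i.succ := rfl

lemma lipschitzWith_dropFirst (n : ℕ) : LipschitzWith 1 (dropFirst n) := by
  refine LipschitzWith.of_dist_le_mul fun x y => ?_
  rw [NNReal.coe_one, one_mul, EuclideanSpace.dist_eq, EuclideanSpace.dist_eq]
  refine Real.sqrt_le_sqrt ?_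
  rw [Fin.sum_univ_succ (n := n)]
  simp only [dropFirst_apply]
  linarith [sq_nonneg (dist (x 0) (y 0))]

lemma surjective_dropFirst (n : ℕ) : Function.Surjective (dropFirst n) := fun y =>
  ⟨WithLp.toLp 2 (Fin.cons 0 (fun i => y i)), by ext i; simp [dropFirst_apply]⟩

/-- A line meets a compact set in a compact set of parameters; its last point cannot be interior,
since the line could then be followed further inside `T`. -/
lemma exists_add_smul_mem_frontier {E : Type*} [NormedAddCommGroup E] [NormedSpace ℝ E]
    {T : Set E} (hT : IsCompact T) {x v : E} (hx : x ∈ T) (hv : v ≠ 0) :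
    ∃ s : ℝ, x + s • v ∈ frontier T := by
  have hemb : Topology.IsClosedEmbedding (fun s : ℝ => x + s • v) :=
    (Homeomorph.addLeft x).isClosedEmbedding.comp (isClosedEmbedding_smul_left hv)
  obtain ⟨s, hs, hmax⟩ := (hemb.isCompact_preimage hT).exists_isGreatest ⟨0, by simpa using hx⟩
  refine ⟨s, ?_⟩
  rw [hT.isClosed.frontier_eq]
  refine ⟨hs, fun hint => ?_⟩
  have hnhds : ∀ᶠ r in 𝓝 s, x + r • v ∈ T :=
    hemb.continuous.continuousAt.eventually (mem_interior_iff_mem_nhds.1 hint)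
  obtain ⟨r, hr, hsr⟩ := ((hnhds.filter_mono nhdsWithin_le_nhds).and
    (self_mem_nhdsWithin : Set.Ioi s ∈ 𝓝[>] s)).exists
  exact absurd (hmax hr) (not_le.2 hsr)

lemma surfaceMeasure_frontier_ne_zero (hN : 2 ≤ N) {T : Set (Sp N)} (hT : IsCompact T)
    (hTi : (interior T).Nonempty) : surfaceMeasure (frontier T) ≠ 0 := by
  obtain ⟨n, rfl⟩ : ∃ n, N = n + 1 := ⟨N - 1, by omega⟩
  -- Moving along the first axis reaches the frontier without changing the projection.
  have hsub : dropFirst n '' interior T ⊆ dropFirst n '' frontier T := by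
    rintro _ ⟨x, hx, rfl⟩
    obtain ⟨s, hs⟩ := exists_add_smul_mem_frontier hT (interior_subset hx)
      (v := (EuclideanSpace.single 0 1 : Sp (n + 1))) (by simp)
    refine ⟨_, hs, ?_⟩
    ext i
    simp [dropFirst_apply]
  have hopen : IsOpen (dropFirst n '' interior T) :=
    (dropFirst n).isOpenMap_of_finiteDimensional (surjective_dropFirst n) _ isOpen_interior
  have hpos : 0 < (volume : Measure (Sp n)) (dropFirst n '' frontier T) :=
    (hopen.measure_pos volume (hTi.image _)).trans_le (measure_mono hsub)
  -- Both sides carry the same normalizing constant, which depends only on the dimension `n` of the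
  -- measure.
  have hle : (Measure.euclideanHausdorffMeasure n : Measure (Sp n)) (dropFirst n '' frontier T)
      ≤ (Measure.euclideanHausdorffMeasure n : Measure (Sp (n + 1))) (frontier T) := by
    simp_rw [Measure.euclideanHausdorffMeasure_def, Measure.smul_apply]
    gcongr
    simpa using (lipschitzWith_dropFirst n).hausdorffMeasure_image_le (d := n) (by positivity)
      (frontier T)
  rw [EuclideanSpace.euclideanHausdorffMeasure_eq_volume] at hle
  rw [surfaceMeasure, ne_eq, Measure.restrict_eq_zero]
  exact (hpos.trans_le hle).ne'

lemma homTheta_pos (hN : 2 ≤ N) {T : Set (Sp N)} (hT : IsCompact T)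
    (hTi : (interior T).Nonempty) {θ : Sp N → ℝ} {α₀ : ℝ} (hα₀ : 0 < α₀)
    (hint : Integrable θ (surfaceMeasure (frontier T)))
    (hθ : ∀ᵐ y ∂(surfaceMeasure (frontier T)), α₀ ≤ θ y) : 0 < homTheta T θ := by
  have hpos : ∀ᵐ y ∂(surfaceMeasure (frontier T)), 0 < θ y :=
    hθ.mono fun y hy => hα₀.trans_le hy
  refine lt_of_le_of_ne (integral_nonneg_of_ae (hpos.mono fun y hy => hy.le)) fun h => ?_
  -- Integrability matters here: the Bochner integral of a non-integrable function is `0` by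
  -- default.
  have h0 := (integral_eq_zero_iff_of_nonneg_ae (hpos.mono fun y hy => hy.le) hint).1 h.symm
  have hF : ∀ᵐ y ∂(surfaceMeasure (frontier T)), False := by
    filter_upwards [hpos, h0] with y h1 h2
    exact h1.ne' h2
  exact surfaceMeasure_frontier_ne_zero hN hT hTi (ae_eq_bot.1 (eventually_false_iff_eq_bot.1 hF))

/-! ### Positivity of the homogenized form -/

section Abstract

variable {X I : Type*} [MeasurableSpace X] [Fintype I] {μ : Measure X}

lemma integrable_mul_mul {a f g : X → ℝ} (ha : MemLp a ∞ μ) (hf : MemLp f 2 μ)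
    (hg : MemLp g 2 μ) : Integrable (fun x => a x * f x * g x) μ :=
  (hf.mul (r := 2) ha).integrable_mul hg

/-- A corrected quadratic form, with correctors `s` solving the Galerkin equations among themselves,
is the energy of the corrected fields, hence nonnegative. -/
lemma sum_corrected_nonneg [IsFiniteMeasure μ] {A : I → I → X → ℝ} {s : I → I → X → ℝ}
    (hA : ∀ p r, MemLp (A p r) ∞ μ) (hs : ∀ m p, MemLp (s m p) 2 μ)
    (hell : ∀ᵐ x ∂μ, ∀ ξ : I → ℝ, 0 ≤ ∑ p, ∑ r, A p r x * ξ p * ξ r)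
    (hcell : ∀ m n, ∑ p, ∑ r, ∫ x, A p r x * s m p x * s n r x ∂μ
      = ∑ r, ∫ x, A m r x * s n r x ∂μ) (ζ : I → ℝ) :
    0 ≤ ∑ m, ∑ n, ((∫ x, A m n x ∂μ) - ∑ p, ∫ x, A p n x * s m p x ∂μ) * ζ m * ζ n := by
  classical
  let ε : I → I → ℝ := fun m p => if p = m then 1 else 0
  let D : I → I → X → ℝ := fun m p x => ε m p - s m p x
  have hD : ∀ m p, MemLp (D m p) 2 μ := fun m p => (memLp_const _).sub (hs m p)
  have h1 : MemLp (fun _ : X => (1 : ℝ)) 2 μ := memLp_const _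
  have hAI : ∀ p r, Integrable (A p r) μ := fun p r => by
    simpa using integrable_mul_mul (hA p r) h1 h1
  have hAs : ∀ p r m q, Integrable (fun x => A p r x * s m q x) μ := fun p r m q => by
    simpa using integrable_mul_mul (hA p r) (hs m q) h1
  have hAss : ∀ p r m q n t, Integrable (fun x => A p r x * s m q x * s n t x) μ :=
    fun p r m q n t => integrable_mul_mul (hA p r) (hs m q) (hs n t)
  have hexp : ∀ m n p r, ∫ x, A p r x * D m p x * D n r x ∂μ
      = ε m p * ε n r * ∫ x, A p r x ∂μ - ε n r * (∫ x, A p r x * s m p x ∂μ)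
        - ε m p * (∫ x, A p r x * s n r x ∂μ) + ∫ x, A p r x * s m p x * s n r x ∂μ := by
    intro m n p r
    have J1 : Integrable (fun x => ε m p * ε n r * A p r x) μ := (hAI p r).const_mul _
    have J2 : Integrable (fun x => ε n r * (A p r x * s m p x)) μ := (hAs p r m p).const_mul _
    have J3 : Integrable (fun x => ε m p * (A p r x * s n r x)) μ := (hAs p r n r).const_mul _
    have J12 : Integrable (fun x => ε m p * ε n r * A p r x - ε n r * (A p r x * s m p x)) μ :=
      J1.sub J2
    have J123 : Integrable (fun x => ε m p * ε n r * A p r x - ε n r * (A p r x * s m p x)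
      - ε m p * (A p r x * s n r x)) μ := J12.sub J3
    rw [← integral_const_mul, ← integral_const_mul, ← integral_const_mul,
      ← integral_sub J1 J2, ← integral_sub J12 J3, ← integral_add J123 (hAss p r m p n r)]
    refine integral_congr_ae (ae_of_all _ fun x => ?_)
    simp only [D]
    ring
  -- Of the four terms of the expansion, `hcell` cancels the last two.
  have hq : ∀ m n, (∫ x, A m n x ∂μ) - ∑ p, ∫ x, A p n x * s m p x ∂μ
      = ∑ p, ∑ r, ∫ x, A p r x * D m p x * D n r x ∂μ := by
    intro m n
    simp only [hexp, Finset.sum_add_distrib, Finset.sum_sub_distrib, hcell]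
    simp [ε, ite_mul, Finset.sum_ite_eq']
  have hI : ∀ p r m n, Integrable (fun x => A p r x * D m p x * D n r x * ζ m * ζ n) μ :=
    fun p r m n => ((integrable_mul_mul (hA p r) (hD m p) (hD n r)).mul_const _).mul_const _
  have htot : ∑ m, ∑ n, ((∫ x, A m n x ∂μ) - ∑ p, ∫ x, A p n x * s m p x ∂μ) * ζ m * ζ n
      = ∫ x, ∑ m, ∑ n, ∑ p, ∑ r, A p r x * D m p x * D n r x * ζ m * ζ n ∂μ := by
    rw [integral_finsetSum _ fun m _ => integrable_finsetSum _ fun n _ =>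
      integrable_finsetSum _ fun p _ => integrable_finsetSum _ fun r _ => hI p r m n]
    refine Finset.sum_congr rfl fun m _ => ?_
    rw [integral_finsetSum _ fun n _ =>
      integrable_finsetSum _ fun p _ => integrable_finsetSum _ fun r _ => hI p r m n]
    refine Finset.sum_congr rfl fun n _ => ?_
    rw [integral_finsetSum _ fun p _ => integrable_finsetSum _ fun r _ => hI p r m n, hq,
      Finset.sum_mul, Finset.sum_mul]
    refine Finset.sum_congr rfl fun p _ => ?_
    rw [integral_finsetSum _ fun r _ => hI p r m n, Finset.sum_mul, Finset.sum_mul]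
    refine Finset.sum_congr rfl fun r _ => ?_
    rw [integral_mul_const, integral_mul_const]
  rw [htot]
  refine integral_nonneg_of_ae ?_
  filter_upwards [hell] with x hx
  -- Pointwise nonnegativity is applied to the corrected field `ζ - ∑ m, ζ m • s m`; the rest
  -- reorders sums.
  refine (hx fun p => ∑ m, D m p x * ζ m).trans_eq ?_
  simp only [Finset.mul_sum, Finset.sum_mul]
  calc _ = ∑ p, ∑ r, ∑ m, ∑ n, A p r x * D m p x * D n r x * ζ m * ζ n := by
        refine Finset.sum_congr rfl fun p _ => Finset.sum_congr rfl fun r _ => ?_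
        rw [Finset.sum_comm]
        refine Finset.sum_congr rfl fun m _ => Finset.sum_congr rfl fun n _ => ?_
        ring
    _ = ∑ p, ∑ m, ∑ n, ∑ r, A p r x * D m p x * D n r x * ζ m * ζ n := by
        refine Finset.sum_congr rfl fun p _ => ?_
        rw [Finset.sum_comm]
        exact Finset.sum_congr rfl fun m _ => Finset.sum_comm
    _ = _ := by
        rw [Finset.sum_comm]
        exact Finset.sum_congr rfl fun m _ => Finset.sum_comm

end Abstract

lemma exists_isCompact_unitCell_subset (N : ℕ) :
    ∃ K : Set (Sp N), IsCompact K ∧ unitCell N ⊆ K := by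
  refine ⟨WithLp.toLp 2 '' Set.pi Set.univ fun _ => Set.Icc (-(1 / 2) : ℝ) (1 / 2),
    (isCompact_univ_pi fun _ => isCompact_Icc).image (PiLp.continuous_toLp 2 _), fun y hy => ?_⟩
  exact ⟨fun i => y i, fun i _ => ⟨(hy i).1.le, (hy i).2.le⟩, rfl⟩

lemma MemH1Sharp.memLp_weakPartial {u : Sp N → ℝ} (hu : MemH1Sharp u) (i : Fin N)
    {K : Set (Sp N)} (hK : IsCompact K) :
    MemLp (weakPartial Set.univ i u) 2 (volume.restrict K) := by
  obtain ⟨g, hg, hgL⟩ := hu.2.1 i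
  have h := hg.weakPartial_ae_eq isOpen_univ
  rw [Measure.restrict_univ] at h
  exact (hgL K hK).ae_eq (ae_restrict_of_ae h.symm)

lemma memLp_strain_of_mem_VY {w : Sp N → Sp N} (hw : w ∈ VY N) {S : Set (Sp N)}
    (hS : S ⊆ unitCell N) (i j : Fin N) :
    MemLp (strain Set.univ w i j) 2 (volume.restrict S) := by
  obtain ⟨K, hK, hYK⟩ := exists_isCompact_unitCell_subset N
  have h := (((hw i).memLp_weakPartial j hK).add ((hw j).memLp_weakPartial i hK)).const_mul (1 / 2)
  exact h.mono_measure (Measure.restrict_mono (hS.trans hYK) le_rfl)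

lemma sum_homCoeff_nonneg {T : Set (Sp N)} {a : Coeff N} {α : ℝ} (hα : 0 ≤ α)
    (ha : ∀ i j k h, MemLp (a i j k h) ∞ volume)
    (hell : ∀ᵐ y, ∀ ζ : Fin N → Fin N → ℝ,
      α * ∑ i, ∑ j, ζ i j ^ 2 ≤ ∑ i, ∑ j, ∑ k, ∑ h, a i j k h y * ζ i j * ζ k h)
    {χ : Fin N → Fin N → Sp N → Sp N} (hχ : ∀ i j, IsCellSolution T a i j (χ i j))
    (ζ : Fin N → Fin N → ℝ) :
    0 ≤ ∑ i, ∑ j, ∑ k, ∑ h, homCoeff T a χ i j k h * ζ i j * ζ k h := by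
  obtain ⟨K, hK, hYK⟩ := exists_isCompact_unitCell_subset N
  have : IsFiniteMeasure ((volume : Measure (Sp N)).restrict (unitCell N \ T)) :=
    isFiniteMeasure_restrict.2
      ((measure_mono (Set.sdiff_subset.trans hYK)).trans_lt hK.measure_lt_top).ne
  -- Index pairs turn the fourth-order tensor into a matrix; the equation for `χ` at `m` is tested
  -- with `χ` at `n`.
  have key := sum_corrected_nonneg (μ := (volume : Measure (Sp N)).restrict (unitCell N \ T))
    (A := fun (p r : Fin N × Fin N) => a p.1 p.2 r.1 r.2)
    (s := fun m p => strain Set.univ (χ m.1 m.2) p.1 p.2)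
    (fun p r => (ha _ _ _ _).restrict _)
    (fun m p => memLp_strain_of_mem_VY (hχ m.1 m.2).1 Set.sdiff_subset _ _)
    (by
      filter_upwards [ae_restrict_of_ae hell] with y hy ξ
      have h := hy fun i j => ξ (i, j)
      simp only [Fintype.sum_prod_type]
      exact le_trans (by positivity) h)
    (fun m n => by
      simpa only [Fintype.sum_prod_type] using (hχ m.1 m.2).2 _ (hχ n.1 n.2).1)
    (fun m => ζ m.1 m.2)
  simpa only [Fintype.sum_prod_type, homCoeff] using key

/-! ### Uniqueness by the energy argument -/

lemma memLp_homStress {Ω : Set (Sp N)} (hΩ : IsOpen Ω) (q : Fin N → Fin N → Fin N → Fin N → ℝ)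
    {u : Sp N → Sp N} (hu : ∀ j, MemH1 Ω (comp u j)) (i j : Fin N) :
    MemLp (homStress Ω q u i j) 2 (volume.restrict Ω) :=
  memLp_finsetSum _ fun k _ => memLp_finsetSum _ fun h _ =>
    (memLp_strain hΩ hu k h).const_mul (q i j k h)

lemma homStress_sub {Ω : Set (Sp N)} (hΩ : IsOpen Ω) (q : Fin N → Fin N → Fin N → Fin N → ℝ)
    {u v : Sp N → Sp N} (hu : ∀ j, MemH1 Ω (comp u j)) (hv : ∀ j, MemH1 Ω (comp v j))
    (i j : Fin N) :
    homStress Ω q (u - v) i j =ᵐ[volume.restrict Ω] homStress Ω q u i j - homStress Ω q v i j := by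
  have h : ∀ᵐ x ∂(volume.restrict Ω), ∀ k h,
      strain Ω (u - v) k h x = strain Ω u k h x - strain Ω v k h x :=
    ae_all_iff.2 fun k => ae_all_iff.2 fun h => strain_sub hΩ hu hv k h
  filter_upwards [h] with x hx
  simp only [homStress, hx, mul_sub, Finset.sum_sub_distrib, Pi.sub_apply]

lemma integrable_inner_of_memLp {F : Type*} [NormedAddCommGroup F] [InnerProductSpace ℝ F]
    {X : Type*} [MeasurableSpace X] {μ : Measure X} {u v : X → F}
    (hu : MemLp u 2 μ) (hv : MemLp v 2 μ) : Integrable (fun x => inner ℝ (u x) (v x)) μ :=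
  (hu.norm.integrable_mul hv.norm).mono' (hu.1.inner hv.1)
    (ae_of_all _ fun x => norm_inner_le_norm (u x) (v x))

/-- Weak solutions are unique when the homogenized form is nonnegative and the zeroth-order
coefficient is positive. -/
theorem IsWeakSolution.ae_eq {Ω Γ₁ Γ₂ : Set (Sp N)} (hΩ : IsOpen Ω)
    {q : Fin N → Fin N → Fin N → Fin N → ℝ}
    (hq : ∀ ζ : Fin N → Fin N → ℝ, 0 ≤ ∑ i, ∑ j, ∑ k, ∑ h, q i j k h * ζ i j * ζ k h)
    {ϑ : ℝ} (hϑ : 0 < ϑ) {F : Sp N} {t u w : Sp N → Sp N}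
    (hu : IsWeakSolution Ω Γ₁ Γ₂ q ϑ F t u) (hw : IsWeakSolution Ω Γ₁ Γ₂ q ϑ F t w) :
    u =ᵐ[volume.restrict Ω] w := by
  obtain ⟨hd1, g, hg, -⟩ := sub_mem_V0 hΩ hu.1 hw.1
  have hu1 := hu.1.1
  have hw1 := hw.1.1
  have huL : MemLp u 2 (volume.restrict Ω) := memLp_of_comp fun j => (hu1 j).1
  have hwL : MemLp w 2 (volume.restrict Ω) := memLp_of_comp fun j => (hw1 j).1
  have hdL := huL.sub hwL
  -- The right-hand sides depend only on the test field and its trace `g`, so they coincide.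
  have heq := (hu.2 _ (sub_mem_V0 hΩ hu.1 hw.1) g hg).trans
    (hw.2 _ (sub_mem_V0 hΩ hu.1 hw.1) g hg).symm
  have hzero : ∫ x in Ω, ϑ * inner ℝ (u x) ((u - w) x) - ϑ * inner ℝ (w x) ((u - w) x)
      = ϑ * ∫ x in Ω, ‖(u - w) x‖ ^ 2 := by
    rw [← integral_const_mul]
    refine integral_congr_ae (ae_of_all _ fun x => ?_)
    simp only [← mul_sub, ← inner_sub_left]
    rw [← Pi.sub_apply u w x, real_inner_self_eq_norm_sq]
  rw [integral_sub ((integrable_inner_of_memLp huL hdL).const_mul ϑ)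
    ((integrable_inner_of_memLp hwL hdL).const_mul ϑ)] at hzero
  have hI : ∀ i j, Integrable (fun x => homStress Ω q (u - w) i j x * strain Ω (u - w) i j x)
      (volume.restrict Ω) := fun i j =>
    (memLp_homStress hΩ q hd1 i j).integrable_mul (memLp_strain hΩ hd1 i j)
  have hstress : (∑ i, ∑ j, ∫ x in Ω, homStress Ω q u i j x * strain Ω (u - w) i j x)
      - (∑ i, ∑ j, ∫ x in Ω, homStress Ω q w i j x * strain Ω (u - w) i j x)
      = ∫ x in Ω, ∑ i, ∑ j, homStress Ω q (u - w) i j x * strain Ω (u - w) i j x := by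
    rw [integral_finsetSum _ fun i _ => integrable_finsetSum _ fun j _ => hI i j,
      ← Finset.sum_sub_distrib]
    refine Finset.sum_congr rfl fun i _ => ?_
    rw [integral_finsetSum _ fun j _ => hI i j, ← Finset.sum_sub_distrib]
    refine Finset.sum_congr rfl fun j _ => ?_
    refine (integral_sub
      ((memLp_homStress hΩ q hu1 i j).integrable_mul (memLp_strain hΩ hd1 i j))
      ((memLp_homStress hΩ q hw1 i j).integrable_mul (memLp_strain hΩ hd1 i j))).symm.trans
      (integral_congr_ae ?_)
    filter_upwards [homStress_sub hΩ q hu1 hw1 i j] with x hx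
    simp only [hx, Pi.sub_apply, sub_mul, Pi.mul_apply]
  -- Semidefiniteness of `q` holds at each point, with `ζ` the strain of the difference there.
  have hnonneg : 0 ≤ ∫ x in Ω, ∑ i, ∑ j, homStress Ω q (u - w) i j x * strain Ω (u - w) i j x := by
    refine integral_nonneg fun x => (hq fun i j => strain Ω (u - w) i j x).trans_eq ?_
    simp only [homStress, Finset.sum_mul]
    refine Finset.sum_congr rfl fun i _ => Finset.sum_congr rfl fun j _ =>
      Finset.sum_congr rfl fun k _ => Finset.sum_congr rfl fun h _ => ?_
    ring
  have hle : ∫ x in Ω, ‖(u - w) x‖ ^ 2 ≤ 0 := by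
    refine nonpos_of_mul_nonpos_right (a := ϑ) ?_ hϑ
    linarith
  have hint : Integrable (fun x => ‖(u - w) x‖ ^ 2) (volume.restrict Ω) := by
    simpa only [real_inner_self_eq_norm_sq] using integrable_inner_of_memLp hdL hdL
  have h0 := (integral_eq_zero_iff_of_nonneg (fun x => sq_nonneg _) hint).1
    (le_antisymm hle (integral_nonneg fun x => sq_nonneg _))
  filter_upwards [h0] with x hx
  simpa [sub_eq_zero] using hx

end Elasticity

theorem proposition3p2 (N : ℕ) (hN : 2 ≤ N)
    -- the domain, its boundary parts, and the reference inclusion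
    (Ω : Set (Elasticity.Sp N)) (hΩo : IsOpen Ω) (hΩb : Bornology.IsBounded Ω)
    (hΩs : Elasticity.HasSmoothBoundary Ω)
    (Γ₁ Γ₂ : Set (Elasticity.Sp N))
    (hΓ₁ : ∃ U : Set (Elasticity.Sp N), IsOpen U ∧ Γ₁ = U ∩ frontier Ω)
    (hΓ₂ : ∃ U : Set (Elasticity.Sp N), IsOpen U ∧ Γ₂ = U ∩ frontier Ω)
    (hΓdisj : Disjoint Γ₁ Γ₂) (hΓ : frontier Ω = closure Γ₁ ∪ closure Γ₂)
    (hΓpos : 0 < Elasticity.surfaceMeasure (frontier Ω) Γ₁)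
    (T : Set (Elasticity.Sp N)) (hTc : IsCompact T) (hTs : Elasticity.HasSmoothBoundary T)
    (hTi : (interior T).Nonempty) (hTY : T ⊆ Elasticity.unitCell N)
    -- the elasticity coefficients
    (a : Elasticity.Coeff N) (α : ℝ) (hα : 0 < α)
    (ha_bdd : ∀ i j k h, MemLp (a i j k h) ∞ volume)
    (ha_symm : ∀ i j k h, ∀ᵐ y, a i j k h y = a j i h k y ∧ a i j k h y = a k h i j y)
    (ha_ell : ∀ᵐ y, ∀ ζ : Fin N → Fin N → ℝ,
      α * ∑ i, ∑ j, ζ i j ^ 2 ≤ ∑ i, ∑ j, ∑ k, ∑ h, a i j k h y * ζ i j * ζ k h)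
    (ha_per : ∀ i j k h, Elasticity.IsYPeriodic (a i j k h))
    -- the Robin coefficient; the last two hypotheses concern its values on the surface of `T`
    (θ : Elasticity.Sp N → ℝ) (α₀ : ℝ) (hα₀ : 0 < α₀)
    (hθ_bdd : MemLp θ ∞ volume) (hθ_low : ∀ᵐ y, α₀ ≤ θ y)
    (hθ_per : Elasticity.IsYPeriodic θ)
    (hθ_int : Integrable θ (Elasticity.surfaceMeasure (frontier T)))
    (hθ_surf : ∀ᵐ y ∂(Elasticity.surfaceMeasure (frontier T)), α₀ ≤ θ y)
    -- the volume force and the surface traction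
    (f : Elasticity.Sp N → Elasticity.Sp N)
    (hf_bdd : MemLp f ∞ volume) (hf_per : Elasticity.IsYPeriodic f)
    (t : Elasticity.Sp N → Elasticity.Sp N)
    (ht : MemLp t 2 (Elasticity.surfaceMeasure (frontier Ω)))
    -- any solutions of the cell problems
    (χ : Fin N → Fin N → Elasticity.Sp N → Elasticity.Sp N)
    (hχ : ∀ i j, Elasticity.IsCellSolution T a i j (χ i j))
    -- two weak solutions of the homogenized problem
    (u w : Elasticity.Sp N → Elasticity.Sp N)
    (hu : Elasticity.IsWeakSolution Ω Γ₁ Γ₂ (Elasticity.homCoeff T a χ)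
      (Elasticity.homTheta T θ) (Elasticity.homForce T f) t u)
    (hw : Elasticity.IsWeakSolution Ω Γ₁ Γ₂ (Elasticity.homCoeff T a χ)
      (Elasticity.homTheta T θ) (Elasticity.homForce T f) t w) :
    ∀ᵐ x ∂(volume.restrict Ω), u x = w x := by
  exact hu.ae_eq hΩo (Elasticity.sum_homCoeff_nonneg hα.le ha_bdd ha_ell hχ)
    (Elasticity.homTheta_pos hN hTc hTi hα₀ hθ_int hθ_surf) hw
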